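/- For integers $1\le n\le N$ and $A\ge 0$, let $\mathbf X=(X_{ij})_{1\le i,j\le N}$ have independent entries $X_{ij}\sim N(\theta_{ij},1)$ (law $\mathbb P_{\theta}$), and let $\Theta(A,n,N)$ be the set of all $\theta\in\mathbb R^{N\times N}$ for which there are sets $R,C\subset\{1,\dots,N\}$ with $|R|=|C|=n$ such that $\theta_{ij}\ge A$ for $(i,j)\in R\times C$ and $\theta_{ij}=0$ otherwise. For a test $T$, i.e. a $\{0,1\}$-valued measurable function of $\mathbf X$, put $$\mathrm{Risk}(T,A,n)=\mathbb P_0(T=1)+\sup_{\theta\in\Theta(A,n,N)}\mathbb P_\theta(T=0).$$ For $\alpha>0$ let $N=\lfloor n^{1+\alpha}\rfloor$ and let $\mathcal R_n(A)=\inf_T \mathrm{Risk}(T,A,n)$, the infimum being over all tests. **Theorem 4 (sparse below-boundary regime).** For $\alpha>1/2$ and $\delta\in(-1,0)$ let $A=A(\delta,\alpha;n)=\sqrt{4(1+\delta)\alpha\log n/n}$. Then, for all such fixed $\alpha,\delta$, $$\lim_{n\to\infty}\frac{\log(1-\mathcal R_n(A))}{\log n}=\frac12-\alpha .$$ Moreover,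 there are absolute constants $c,C\in(0,\infty)$ such that for all such $\alpha,\delta$ there is $n_0(\alpha,\delta)<\infty$ with $$c\le\frac{1-\mathcal R_n(A)}{\sqrt{(1+\delta)\alpha}\;n^{1/2-\alpha}\sqrt{\log n}}\le C\qquad\text{for all } n\ge n_0(\alpha,\delta).$$ This rate is attained by the sum test $T=\mathbf 1\{\sum_{i,j}X_{ij}>0\}$: the same two-sided bound holds with $\mathrm{Risk}(T,A,n)$ in place of $\mathcal R_n(A)$. -/

import Mathlib

open MeasureTheory ProbabilityTheory Filter Topology

namespace SubmatrixDetection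

noncomputable section

/-- The space of `N × N` real data matrices, indexed by pairs (row, column). -/
abbrev Obs (N : ℕ) : Type := Fin N × Fin N → ℝ

/-- The law of an `N × N` matrix with independent entries `X_{ij} ~ N(θ_{ij}, 1)`. -/
def law {N : ℕ} (θ : Obs N) : Measure (Obs N) :=
  Measure.pi fun p => gaussianReal (θ p) 1

/-- The alternatives: mean matrices that are at least `A` on some `n × n` submatrix
(rows `R`, columns `C`, not necessarily contiguous) and zero elsewhere. -/
def altSet (A : ℝ) (n N : ℕ) : Set (Obs N) :=
  {θ | ∃ R C : Finset (Fin N), R.card = n ∧ C.card = n ∧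
    (∀ i j, i ∈ R → j ∈ C → A ≤ θ (i, j)) ∧
    (∀ i j, ¬ (i ∈ R ∧ j ∈ C) → θ (i, j) = 0)}

/-- A (nonrandomized) test: a measurable `{0, 1}`-valued function of the data. -/
def Test (N : ℕ) : Type := {T : Obs N → Fin 2 // Measurable T}

/-- The maximum risk of a test: type I error plus worst-case type II error. -/
def risk {N : ℕ} (T : Test N) (A : ℝ) (n : ℕ) : ℝ :=
  (law (0 : Obs N)).real {x | T.1 x = 1} +
    ⨆ θ : altSet A n N, (law θ.1).real {x | T.1 x = 0}

/-- The ambient dimension `N = ⌊n^(1+α)⌋`. -/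
def ambientDim (n : ℕ) (α : ℝ) : ℕ := ⌊(n : ℝ) ^ (1 + α)⌋₊

/-- The minimax risk at signal strength `A`, submatrix size `n` and `N = ⌊n^(1+α)⌋`. -/
def minimaxRisk (n : ℕ) (A α : ℝ) : ℝ :=
  ⨅ T : Test (ambientDim n α), risk T A n

/-- The signal strength `√(4 (1+δ) α log n / n)`. -/
def signal (δ α : ℝ) (n : ℕ) : ℝ :=
  Real.sqrt (4 * (1 + δ) * α * Real.log n / n)

/-- The sum test with threshold `H`: reject iff the sum of all entries exceeds `H`. -/
def sumTest (N : ℕ) (H : ℝ) : Test N :=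
  ⟨fun x => if H < ∑ p, x p then 1 else 0,
    Measurable.ite (measurableSet_lt measurable_const (by fun_prop))
      measurable_const measurable_const⟩

/-- The rate `√((1+δ) α) n^(1/2-α) √(log n)`. -/
def rate (δ α : ℝ) (n : ℕ) : ℝ :=
  Real.sqrt ((1 + δ) * α) * (n : ℝ) ^ (1 / 2 - α) * Real.sqrt (Real.log n)

end

end SubmatrixDetection

namespace SubmatrixDetection

/-! Both bounds on `1 - risk` come from one quantity: `A n² / N`, the shift of the total sum in
units of its standard deviation `N`, which is about `2 * rate` up to rounding of `N`.

Sum test. The sum is normal with mean at least `A n²` under any alternative, so `1 - risk` is at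
least the standard normal mass of an interval of length `A n² / N` adjacent to `0`, hence at least a
constant times `rate` (`le_one_sub_risk_sumTest`).

Arbitrary tests. Replace the supremum by the average over all `n × n` spikes at level exactly `A`;
then `1 - risk` is at most the `L²` distance from `1` of the mixture likelihood ratio. The plain
second moment averages `exp (A² k l)` over row and column overlaps `k`, `l`. Full overlap has
probability about `n ^ (-2 α n)` but weight `n ^ (4 (1+δ) α n)`, which may diverge. Truncating each
likelihood ratio where its block sum is atypically large replaces `k l` by about `n² k l / (n² + k
l)` (`integral_truncatedRatio_mul_le`). At full overlap this halves the exponent, and `δ < 0` then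
suffices.

Overlaps at most `n ^ β` contribute `1 + O(A² 𝔼k 𝔼l)`, where `𝔼k = 𝔼l = n² / N`; this excess is of
order `rate ^ 2` and its square root gives the rate. Larger overlaps contribute a superpolynomially
small amount (`overlapBound_mul_exp_le`). -/

/-! ### Gaussian likelihood ratios and the law of the sum. -/

instance isProbabilityMeasure_law {N : ℕ} (θ : Obs N) : IsProbabilityMeasure (law θ) := by
  unfold law; infer_instance

/-- The likelihood ratio of `law θ` with respect to `law 0`. -/
noncomputable def likelihoodRatio {N : ℕ} (θ x : Obs N) : ℝ :=
  Real.exp (∑ p, (θ p * x p - θ p ^ 2 / 2))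

lemma measurable_likelihoodRatio {N : ℕ} (θ : Obs N) : Measurable (likelihoodRatio θ) := by
  unfold likelihoodRatio; fun_prop

lemma likelihoodRatio_pos {N : ℕ} (θ x : Obs N) : 0 < likelihoodRatio θ x := Real.exp_pos _

lemma integrable_exp_linear {N : ℕ} (c : Obs N) :
    Integrable (fun x => Real.exp (∑ p, c p * x p)) (law (0 : Obs N)) := by
  simp_rw [Real.exp_sum]
  exact Integrable.fintype_prod (f := fun p y => Real.exp (c p * y))
    fun p => integrable_exp_mul_gaussianReal (c p)

lemma integral_exp_linear {N : ℕ} (c : Obs N) :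
    ∫ x, Real.exp (∑ p, c p * x p) ∂law (0 : Obs N) = Real.exp (∑ p, c p ^ 2 / 2) := by
  simp_rw [Real.exp_sum]
  unfold law
  rw [integral_fintype_prod_eq_prod (fun p y => Real.exp (c p * y))]
  refine Finset.prod_congr rfl fun p _ => ?_
  have := congrFun (mgf_fun_id_gaussianReal (μ := (0 : Obs N) p) (v := 1)) (c p)
  simpa [mgf] using this

lemma gaussianReal_apply_eq_integral_exp (t : ℝ) {s : Set ℝ} (hs : MeasurableSet s) :
    gaussianReal t 1 s = ENNReal.ofReal
      (∫ y, s.indicator (fun y => Real.exp (t * y - t ^ 2 / 2)) y ∂gaussianReal 0 1) := by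
  rw [gaussianReal_apply_eq_integral _ one_ne_zero, integral_gaussianReal_eq_integral_smul one_ne_zero,
    ← integral_indicator hs]
  congr 2
  ext y
  by_cases hy : y ∈ s
  · simp only [Set.indicator_of_mem hy, gaussianPDFReal, smul_eq_mul, mul_assoc, ← Real.exp_add]
    congr 2
    simp only [NNReal.coe_one]
    ring
  · simp [Set.indicator_of_notMem hy]

lemma law_eq_withDensity {N : ℕ} (θ : Obs N) :
    law θ = (law 0).withDensity fun x => ENNReal.ofReal (likelihoodRatio θ x) := by
  refine Measure.pi_eq fun s hs => ?_
  have hint (p : Fin N × Fin N) :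
      Integrable ((s p).indicator fun y => Real.exp (θ p * y - θ p ^ 2 / 2)) (gaussianReal 0 1) := by
    refine Integrable.indicator ?_ (hs p)
    simp_rw [Real.exp_sub]
    exact (integrable_exp_mul_gaussianReal _).div_const _
  have hnn (p : Fin N × Fin N) (y : ℝ) :
      0 ≤ (s p).indicator (fun y => Real.exp (θ p * y - θ p ^ 2 / 2)) y :=
    Set.indicator_nonneg (fun _ _ => (Real.exp_pos _).le) _
  have hprod (x : Obs N) : (Set.univ.pi s).indicator (fun x => ENNReal.ofReal (likelihoodRatio θ x)) x
      = ENNReal.ofReal (∏ p, (s p).indicator (fun y => Real.exp (θ p * y - θ p ^ 2 / 2)) (x p)) := by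
    by_cases hx : x ∈ Set.univ.pi s
    · rw [Set.indicator_of_mem hx, likelihoodRatio, Real.exp_sum]
      congr 1
      exact Finset.prod_congr rfl fun p _ => by rw [Set.indicator_of_mem (hx p (Set.mem_univ p))]
    · rw [Set.indicator_of_notMem hx]
      simp only [Set.mem_pi, Set.mem_univ, true_imp_iff, not_forall] at hx
      obtain ⟨p, hp⟩ := hx
      rw [Finset.prod_eq_zero (Finset.mem_univ p) (by rw [Set.indicator_of_notMem hp]),
        ENNReal.ofReal_zero]
  rw [withDensity_apply _ (MeasurableSet.univ_pi hs), ← lintegral_indicator (MeasurableSet.univ_pi hs)]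
  simp_rw [hprod]
  have hintprod : Integrable (fun x : Obs N => ∏ p, (s p).indicator
      (fun y => Real.exp (θ p * y - θ p ^ 2 / 2)) (x p)) (law 0) :=
    Integrable.fintype_prod (f := fun p => (s p).indicator
      (fun y => Real.exp (θ p * y - θ p ^ 2 / 2))) hint
  rw [← ofReal_integral_eq_lintegral_ofReal hintprod (ae_of_all _ fun x => Finset.prod_nonneg fun p _ => hnn p _)]
  have := integral_fintype_prod_eq_prod (μ := fun p => gaussianReal ((0 : Obs N) p) 1)
    (fun p => (s p).indicator (fun y => Real.exp (θ p * y - θ p ^ 2 / 2)))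
  unfold law
  rw [this, ENNReal.ofReal_prod_of_nonneg fun p _ => integral_nonneg (hnn p)]
  exact Finset.prod_congr rfl fun p _ => (gaussianReal_apply_eq_integral_exp _ (hs p)).symm

lemma integrable_likelihoodRatio {N : ℕ} (θ : Obs N) :
    Integrable (likelihoodRatio θ) (law 0) := by
  unfold likelihoodRatio
  simp_rw [Finset.sum_sub_distrib, Real.exp_sub]
  exact (integrable_exp_linear θ).div_const _

lemma law_real_eq_setIntegral {N : ℕ} (θ : Obs N) {s : Set (Obs N)} (hs : MeasurableSet s) :
    (law θ).real s = ∫ x in s, likelihoodRatio θ x ∂law 0 := by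
  rw [measureReal_def, law_eq_withDensity, withDensity_apply _ hs,
    ← ofReal_integral_eq_lintegral_ofReal (integrable_likelihoodRatio θ).integrableOn
      (ae_of_all _ fun x => (likelihoodRatio_pos θ x).le),
    ENNReal.toReal_ofReal (integral_nonneg fun x => (likelihoodRatio_pos θ x).le)]

lemma integral_likelihoodRatio {N : ℕ} (θ : Obs N) : ∫ x, likelihoodRatio θ x ∂law 0 = 1 := by
  rw [← setIntegral_univ, ← law_real_eq_setIntegral θ MeasurableSet.univ, probReal_univ]

lemma law_map_sum {N : ℕ} (θ : Obs N) :
    (law θ).map (fun x => ∑ p, x p) = gaussianReal (∑ p, θ p) ((N : NNReal) ^ 2) := by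
  have hm : Measurable fun x : Obs N => ∑ p, x p := by fun_prop
  have := Measure.isProbabilityMeasure_map (μ := law θ) hm.aemeasurable
  refine Measure.ext_of_charFun (funext fun t => ?_)
  rw [charFun_gaussianReal, charFun_apply_real, integral_map hm.aemeasurable (by fun_prop)]
  simp_rw [Complex.ofReal_sum, Finset.mul_sum, Finset.sum_mul, Complex.exp_sum]
  unfold law
  rw [integral_fintype_prod_eq_prod (fun _ (y : ℝ) => Complex.exp (t * (y : ℂ) * Complex.I))]
  have (p : Fin N × Fin N) : ∫ y, Complex.exp (t * (y : ℂ) * Complex.I) ∂gaussianReal (θ p) 1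
      = Complex.exp (t * θ p * Complex.I - t ^ 2 / 2) := by
    rw [← charFun_apply_real, charFun_gaussianReal]; simp
  simp_rw [this]
  rw [← Complex.exp_sum, Finset.sum_sub_distrib]
  simp only [← Finset.sum_mul, ← Finset.mul_sum]
  simp
  ring_nf

/-! ### Truncated likelihood ratios and the second moment method. -/

/-- The mean matrix equal to `A` on `S` and to `0` elsewhere. -/
noncomputable def spike {N : ℕ} (A : ℝ) (S : Finset (Fin N × Fin N)) : Obs N :=
  fun p => if p ∈ S then A else 0

lemma likelihoodRatio_spike {N : ℕ} (A : ℝ) (S : Finset (Fin N × Fin N)) (x : Obs N) :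
    likelihoodRatio (spike A S) x = Real.exp (A * ∑ p ∈ S, x p - A ^ 2 * S.card / 2) := by
  simp only [likelihoodRatio, spike, ite_mul, zero_mul, ite_pow, ite_div,
    Finset.sum_sub_distrib]
  simp [Finset.mul_sum]
  ring

/-- The likelihood ratio of the spike on `S`, truncated where the sum over `S` exceeds `T`. -/
noncomputable def truncatedRatio {N : ℕ} (A T : ℝ) (S : Finset (Fin N × Fin N)) (x : Obs N) : ℝ :=
  if ∑ p ∈ S, x p ≤ T then likelihoodRatio (spike A S) x else 0

section truncatedRatio

variable {N : ℕ} (A T : ℝ) (S : Finset (Fin N × Fin N))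

lemma measurable_truncatedRatio : Measurable (truncatedRatio A T S) :=
  Measurable.ite (measurableSet_le (by fun_prop) measurable_const)
    (measurable_likelihoodRatio _) measurable_const

lemma truncatedRatio_nonneg (x : Obs N) : 0 ≤ truncatedRatio A T S x := by
  unfold truncatedRatio
  split_ifs
  exacts [(likelihoodRatio_pos _ _).le, le_rfl]

lemma truncatedRatio_le (x : Obs N) : truncatedRatio A T S x ≤ likelihoodRatio (spike A S) x := by
  unfold truncatedRatio
  split_ifs
  exacts [le_rfl, (likelihoodRatio_pos _ _).le]

lemma truncatedRatio_le_exp (hA : 0 ≤ A) (x : Obs N) :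
    truncatedRatio A T S x ≤ Real.exp (A * T) := by
  unfold truncatedRatio
  split_ifs with h
  · rw [likelihoodRatio_spike]
    refine Real.exp_le_exp.2 ?_
    have := mul_le_mul_of_nonneg_left h hA
    have : 0 ≤ A ^ 2 * S.card / 2 := by positivity
    linarith
  · positivity

lemma integrable_truncatedRatio (hA : 0 ≤ A) : Integrable (truncatedRatio A T S) (law 0) :=
  Integrable.of_bound (measurable_truncatedRatio A T S).aestronglyMeasurable (Real.exp (A * T))
    (ae_of_all _ fun x => by
      rw [Real.norm_of_nonneg (truncatedRatio_nonneg A T S x)]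
      exact truncatedRatio_le_exp A T S hA x)

lemma integrable_truncatedRatio_mul (hA : 0 ≤ A) (S' : Finset (Fin N × Fin N)) :
    Integrable (fun x => truncatedRatio A T S x * truncatedRatio A T S' x) (law 0) :=
  (integrable_truncatedRatio A T S hA).mul_bdd (c := Real.exp (A * T))
    (measurable_truncatedRatio A T S').aestronglyMeasurable (ae_of_all _ fun x => by
      rw [Real.norm_of_nonneg (truncatedRatio_nonneg A T S' x)]
      exact truncatedRatio_le_exp A T S' hA x)

end truncatedRatio

lemma integrable_exp_mul_sum {N : ℕ} (a b : ℝ) (S S' : Finset (Fin N × Fin N)) :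
    Integrable (fun x => Real.exp (a * ∑ p ∈ S, x p + b * ∑ p ∈ S', x p)) (law (0 : Obs N)) := by
  convert integrable_exp_linear (fun p => spike a S p + spike b S' p) using 3 with x
  simp [spike, add_mul, Finset.sum_add_distrib, Finset.mul_sum]

lemma integral_exp_mul_sum {N : ℕ} (a b : ℝ) (S S' : Finset (Fin N × Fin N)) :
    ∫ x, Real.exp (a * ∑ p ∈ S, x p + b * ∑ p ∈ S', x p) ∂law (0 : Obs N)
      = Real.exp ((a ^ 2 * S.card + b ^ 2 * S'.card + 2 * a * b * (S ∩ S').card) / 2) := by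
  convert integral_exp_linear (fun p => spike a S p + spike b S' p) using 2
  · ext x
    simp [spike, add_mul, Finset.sum_add_distrib, Finset.mul_sum]
  · have (p : Fin N × Fin N) : (spike a S p + spike b S' p) ^ 2 / 2
        = (if p ∈ S then a ^ 2 / 2 else 0) + (if p ∈ S' then b ^ 2 / 2 else 0)
          + (if p ∈ S ∩ S' then a * b else 0) := by
      by_cases h : p ∈ S <;> by_cases h' : p ∈ S' <;> simp [spike, h, h']
      ring
    simp only [this, Finset.sum_add_distrib, Finset.sum_ite_mem, Finset.univ_inter,
      Finset.sum_const, nsmul_eq_mul]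
    ring

/-- Chernoff bound: under the spike the block sum is `N(A m, m)`, so the threshold lies `η A m`
above its mean. The indicator of exceeding `T` is dominated by the exponential tilt of slope `A η`,
the optimal one. -/
lemma one_sub_integral_truncatedRatio_le {N : ℕ} {A η : ℝ} (hA : 0 ≤ A) (hη : 0 ≤ η) {m : ℕ}
    {S : Finset (Fin N × Fin N)} (hS : S.card = m) :
    1 - ∫ x, truncatedRatio A (A * m * (1 + η)) S x ∂law 0 ≤ Real.exp (-(A ^ 2 * m * η ^ 2 / 2)) := by
  set T := A * m * (1 + η)
  have hi := (integrable_exp_mul_sum (A * (1 + η)) 0 S S).mul_const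
    (Real.exp (-(A ^ 2 * m / 2) - A * η * T))
  calc
    1 - ∫ x, truncatedRatio A T S x ∂law 0
        = ∫ x, (likelihoodRatio (spike A S) x - truncatedRatio A T S x) ∂law 0 := by
          rw [integral_sub (integrable_likelihoodRatio _) (integrable_truncatedRatio _ _ _ hA),
            integral_likelihoodRatio]
    _ ≤ ∫ x, Real.exp (A * (1 + η) * ∑ p ∈ S, x p + 0 * ∑ p ∈ S, x p) *
          Real.exp (-(A ^ 2 * m / 2) - A * η * T) ∂law 0 := by
          refine integral_mono ((integrable_likelihoodRatio _).sub
            (integrable_truncatedRatio _ _ _ hA)) hi fun x => ?_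
          simp only [truncatedRatio]
          split_ifs with h
          · simp only [sub_self]; positivity
          · rw [sub_zero, likelihoodRatio_spike, ← Real.exp_add, hS]
            refine Real.exp_le_exp.2 ?_
            have := mul_le_mul_of_nonneg_left (not_le.1 h).le (mul_nonneg hA hη)
            linarith
    _ = Real.exp (-(A ^ 2 * m * η ^ 2 / 2)) := by
          rw [integral_mul_const, integral_exp_mul_sum, ← Real.exp_add, hS]
          congr 1
          simp only [T]
          ring

/-- On the truncation event both block sums are at most `T`, so a fraction `u` of each exponent can
be replaced by its value at `T` before integrating. Without truncation the exponent would be `A² k`,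
with `k` the size of the intersection. -/
lemma integral_truncatedRatio_mul_le {N : ℕ} {A η : ℝ} (hA : 0 ≤ A) {m : ℕ} (hm : 0 < m)
    {S S' : Finset (Fin N × Fin N)} (hS : S.card = m) (hS' : S'.card = m) :
    ∫ x, truncatedRatio A (A * m * (1 + η)) S x * truncatedRatio A (A * m * (1 + η)) S' x ∂law 0
      ≤ Real.exp (A ^ 2 * (1 + 2 * η) * (m * (S ∩ S').card / (m + (S ∩ S').card))) := by
  set T := A * m * (1 + η)
  set k : ℝ := ((S ∩ S').card : ℝ)
  have hk : 0 ≤ k := Nat.cast_nonneg _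
  have hm' : (0 : ℝ) < m := Nat.cast_pos.2 hm
  -- This fraction minimises the resulting exponent when `η = 0`.
  set u : ℝ := k / (m + k) with hu
  have hu0 : 0 ≤ u := by positivity
  have hi := (integrable_exp_mul_sum (A * (1 - u)) (A * (1 - u)) S S').mul_const
    (Real.exp (-(A ^ 2 * m) + 2 * u * A * T))
  calc
    _ ≤ ∫ x, Real.exp (A * (1 - u) * ∑ p ∈ S, x p + A * (1 - u) * ∑ p ∈ S', x p) *
          Real.exp (-(A ^ 2 * m) + 2 * u * A * T) ∂law 0 := by
          refine integral_mono (integrable_truncatedRatio_mul _ _ _ hA _) hi fun x => ?_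
          simp only [truncatedRatio]
          split_ifs with h h'
          · rw [likelihoodRatio_spike, likelihoodRatio_spike, ← Real.exp_add, ← Real.exp_add, hS,
              hS']
            refine Real.exp_le_exp.2 ?_
            have h1 := mul_le_mul_of_nonneg_left h (mul_nonneg hu0 hA)
            have h2 := mul_le_mul_of_nonneg_left h' (mul_nonneg hu0 hA)
            linarith
          all_goals simp only [mul_zero, zero_mul]; positivity
    _ = _ := by
          rw [integral_mul_const, integral_exp_mul_sum, ← Real.exp_add, hS, hS']
          congr 1
          simp only [T, hu]
          field_simp
          ring

/-- Lower bound for the risk of testing `0` against a uniform mixture of spikes, by a second moment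
of truncated likelihood ratios. -/
lemma law_zero_sub_average_le {N : ℕ} {ι : Type*} (P : Finset ι) (hP : P.Nonempty)
    (S : ι → Finset (Fin N × Fin N)) {m : ℕ} (hm : 0 < m) (hS : ∀ i ∈ P, (S i).card = m)
    {A η D : ℝ} (hA : 0 ≤ A) (hη : 0 ≤ η)
    (hD : ∀ i ∈ P, ∑ j ∈ P, Real.exp (A ^ 2 * (1 + 2 * η) *
      (m * (S i ∩ S j).card / (m + (S i ∩ S j).card))) ≤ P.card * (1 + D))
    {B : Set (Obs N)} (hB : MeasurableSet B) :
    (law 0).real B - (∑ i ∈ P, (law (spike A (S i))).real B) / P.card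
      ≤ Real.sqrt (2 * Real.exp (-(A ^ 2 * m * η ^ 2 / 2)) + D) := by
  set T := A * m * (1 + η)
  set ρ := Real.exp (-(A ^ 2 * m * η ^ 2 / 2))
  have hc : (0 : ℝ) < P.card := Nat.cast_pos.2 hP.card_pos
  set M : Obs N → ℝ := fun x => (∑ i ∈ P, truncatedRatio A T (S i) x) / P.card with hM
  have hMi : Integrable M (law 0) :=
    (integrable_finsetSum _ fun i _ => integrable_truncatedRatio A T (S i) hA).div_const _
  have hMsq (x) : M x ^ 2 = (∑ i ∈ P, ∑ j ∈ P, truncatedRatio A T (S i) x *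
      truncatedRatio A T (S j) x) / P.card ^ 2 := by
    rw [hM, div_pow, sq (∑ i ∈ P, _), Finset.sum_mul_sum]
  have hMsqi : Integrable (fun x => M x ^ 2) (law 0) := by
    simp_rw [hMsq]
    exact (integrable_finsetSum _ fun i _ => integrable_finsetSum _ fun j _ =>
      integrable_truncatedRatio_mul A T (S i) hA (S j)).div_const _
  have hM1 : 1 - ρ ≤ ∫ x, M x ∂law 0 := by
    rw [integral_div, integral_finsetSum _ fun i _ => integrable_truncatedRatio A T (S i) hA,
      le_div_iff₀ hc]
    calc (1 - ρ) * P.card = ∑ i ∈ P, (1 - ρ) := by rw [Finset.sum_const, nsmul_eq_mul, mul_comm]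
      _ ≤ _ := Finset.sum_le_sum fun i hi => by
        have := one_sub_integral_truncatedRatio_le hA hη (hS i hi)
        linarith
  have hM2 : ∫ x, M x ^ 2 ∂law 0 ≤ 1 + D := by
    simp_rw [hMsq]
    rw [integral_div, integral_finsetSum _ fun i _ => integrable_finsetSum _ fun j _ =>
      integrable_truncatedRatio_mul A T (S i) hA (S j), div_le_iff₀ (by positivity)]
    calc _ ≤ ∑ i ∈ P, (P.card * (1 + D) : ℝ) := Finset.sum_le_sum fun i hi => by
          rw [integral_finsetSum _ fun j _ => integrable_truncatedRatio_mul A T (S i) hA (S j)]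
          exact (Finset.sum_le_sum fun j hj =>
            integral_truncatedRatio_mul_le hA hm (hS i hi) (hS j hj)).trans (hD i hi)
      _ = _ := by simp; ring
  -- Truncation only lowers each likelihood ratio, which is the direction needed here.
  have h1 : (law 0).real B - (∑ i ∈ P, (law (spike A (S i))).real B) / P.card
      ≤ ∫ x in B, (1 - M x) ∂law 0 := by
    rw [integral_sub (integrable_const _) hMi.integrableOn]
    simp only [integral_const, smul_eq_mul, mul_one, measureReal_restrict_apply_univ]
    refine sub_le_sub_left ?_ _
    simp only [hM]
    rw [integral_div, integral_finsetSum _ fun i _ =>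
      (integrable_truncatedRatio A T (S i) hA).integrableOn]
    refine div_le_div_of_nonneg_right (Finset.sum_le_sum fun i _ => ?_) hc.le
    rw [law_real_eq_setIntegral _ hB]
    exact integral_mono (integrable_truncatedRatio A T (S i) hA).integrableOn
      (integrable_likelihoodRatio _).integrableOn fun x => truncatedRatio_le A T (S i) x
  have hdi : Integrable (fun x => 1 - M x) (law 0) := (integrable_const _).sub hMi
  have hdsqi : Integrable (fun x => (1 - M x) ^ 2) (law 0) := by
    have : (fun x => (1 - M x) ^ 2) = fun x => 1 - 2 * M x + M x ^ 2 := by ext; ring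
    rw [this]
    exact ((integrable_const _).sub (hMi.const_mul 2)).add hMsqi
  have h2 : ∫ x in B, (1 - M x) ∂law 0 ≤ ∫ x, |1 - M x| ∂law 0 :=
    (integral_mono hdi.integrableOn hdi.abs.integrableOn fun x => le_abs_self _).trans
      (setIntegral_le_integral hdi.abs (ae_of_all _ fun x => abs_nonneg _))
  -- Cauchy–Schwarz, in the form of nonnegativity of a variance.
  have h3 : (∫ x, |1 - M x| ∂law 0) ^ 2 ≤ ∫ x, (1 - M x) ^ 2 ∂law 0 := by
    have hmem : MemLp (fun x => |1 - M x|) 2 (law (0 : Obs N)) := by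
      rw [memLp_two_iff_integrable_sq hdi.abs.aestronglyMeasurable]
      simpa only [sq_abs] using hdsqi
    have := variance_nonneg (fun x => |1 - M x|) (law (0 : Obs N))
    rw [variance_eq_sub hmem] at this
    simp only [Pi.pow_apply, sq_abs] at this
    linarith
  have h4 : ∫ x, (1 - M x) ^ 2 ∂law 0 ≤ 2 * ρ + D := by
    have : (fun x => (1 - M x) ^ 2) = fun x => 1 - 2 * M x + M x ^ 2 := by ext; ring
    have hlin : Integrable (fun x => 1 - 2 * M x) (law 0) :=
      (integrable_const _).sub (hMi.const_mul 2)
    rw [this, integral_add hlin hMsqi, integral_sub (integrable_const _) (hMi.const_mul 2), integral_const_mul]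
    simp only [integral_const, probReal_univ, smul_eq_mul, mul_one]
    linarith
  exact h1.trans (h2.trans (Real.le_sqrt_of_sq_le (h3.trans h4)))

/-! ### Overlaps of uniformly random `n`-subsets. -/

/-- Double counting of the pairs `(Q, R')` with `Q ⊆ R ∩ R'` and `|Q| = k`. The case `k = 1` gives
the mean overlap; general `k` gives the tail. -/
lemma sum_choose_card_inter {α : Type*} [DecidableEq α] {R s : Finset α} (hR : R ⊆ s) {n k : ℕ}
    (hk : k ≤ n) :
    ∑ R' ∈ s.powersetCard n, (R ∩ R').card.choose k
      = R.card.choose k * (s.card - k).choose (n - k) := by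
  have h (R' : Finset α) :
      (R ∩ R').card.choose k = ∑ Q ∈ R.powersetCard k, if Q ⊆ R' then 1 else 0 := by
    rw [← Finset.card_powersetCard, ← Finset.card_filter]
    congr 1
    ext Q
    simp only [Finset.mem_powersetCard, Finset.mem_filter, Finset.subset_inter_iff]
    tauto
  simp_rw [h]
  rw [Finset.sum_comm]
  have h' (Q : Finset α) (hQ : Q ∈ R.powersetCard k) :
      ∑ R' ∈ s.powersetCard n, (if Q ⊆ R' then 1 else 0) = (s.card - k).choose (n - k) := by
    rw [Finset.mem_powersetCard] at hQ
    rw [← Finset.card_filter, Finset.card_filter_powersetCard_subset Q s n (hQ.1.trans hR)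
      (hQ.2 ▸ hk), hQ.2]
  rw [Finset.sum_congr rfl h', Finset.sum_const, Finset.card_powersetCard, smul_eq_mul]

lemma descFactorial_mul_pow_le {n N : ℕ} (h : n ≤ N) (k : ℕ) :
    n.descFactorial k * N ^ k ≤ n ^ k * N.descFactorial k := by
  induction k with
  | zero => simp
  | succ k ih =>
    rw [Nat.descFactorial_succ, Nat.descFactorial_succ, pow_succ, pow_succ]
    have h1 : (n - k) * N ≤ n * (N - k) := by
      rw [Nat.sub_mul, Nat.mul_sub]
      have := Nat.mul_le_mul_left k h
      rw [mul_comm n k]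
      omega
    calc _ = ((n - k) * N) * (n.descFactorial k * N ^ k) := by ring
      _ ≤ (n * (N - k)) * (n ^ k * N.descFactorial k) := Nat.mul_le_mul h1 ih
      _ = _ := by ring

/-- After division by `N.choose n`, the left side is the probability that a random `n`-set contains
a given `k`-set, a product of factors `(n - i) / (N - i) ≤ n / N`. -/
lemma choose_sub_sub_le {n N k : ℕ} (hk : k ≤ n) (hN : n ≤ N) (hn : 0 < n) :
    ((N - k).choose (n - k) : ℝ) ≤ N.choose n * ((n : ℝ) / N) ^ k := by
  have hN0 : (0 : ℝ) < N := by exact_mod_cast hn.trans_le hN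
  have h1 : (N.choose n * n.choose k : ℝ) = N.choose k * (N - k).choose (n - k) := by
    exact_mod_cast Nat.choose_mul hk
  have h2 : (n.choose k * N ^ k : ℝ) ≤ n ^ k * N.choose k := by
    have := descFactorial_mul_pow_le hN k
    rw [Nat.descFactorial_eq_factorial_mul_choose, Nat.descFactorial_eq_factorial_mul_choose] at this
    have : n.choose k * N ^ k ≤ n ^ k * N.choose k :=
      Nat.le_of_mul_le_mul_left (by linarith) (Nat.factorial_pos k)
    exact_mod_cast this
  have hc : (0 : ℝ) < N.choose k := by exact_mod_cast Nat.choose_pos (hk.trans hN)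
  rw [div_pow, ← mul_div_assoc, le_div_iff₀ (by positivity)]
  refine le_of_mul_le_mul_left ?_ hc
  calc _ = (N.choose n : ℝ) * (n.choose k * N ^ k) := by rw [← mul_assoc, ← h1]; ring
    _ ≤ N.choose n * (n ^ k * N.choose k) := by gcongr
    _ = _ := by ring

lemma choose_le_exp_mul_div_pow (n k : ℕ) : (n.choose k : ℝ) ≤ (Real.exp 1 * n / k) ^ k := by
  rcases Nat.eq_zero_or_pos k with rfl | hk
  · simp
  have hk' : (0 : ℝ) < k := by exact_mod_cast hk
  refine (Nat.choose_le_pow_div k n).trans ?_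
  have := Real.pow_div_factorial_le_exp k hk'.le k
  rw [div_pow, mul_pow, ← Real.exp_nat_mul, mul_one]
  rw [div_le_iff₀ (by positivity)] at this
  rw [div_le_div_iff₀ (by positivity) (by positivity)]
  calc (n : ℝ) ^ k * k ^ k ≤ n ^ k * (Real.exp k * k.factorial) := by gcongr
    _ = _ := by ring

/-- An upper bound for the probability that two random `n`-subsets of an `N`-set share `k` points. -/
noncomputable def overlapBound (n N k : ℕ) : ℝ := min 1 ((Real.exp 1 * n ^ 2 / (N * k)) ^ k)

lemma overlapBound_pos {n N : ℕ} (hn : 0 < n) (hN : n ≤ N) (k : ℕ) : 0 < overlapBound n N k := by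
  have : 0 < N := hn.trans_le hN
  refine lt_min one_pos ?_
  rcases Nat.eq_zero_or_pos k with rfl | hk
  · simp
  · positivity

lemma card_filter_card_inter_le {n N : ℕ} (hn : 0 < n) (hN : n ≤ N) {R : Finset (Fin N)}
    (hR : R.card = n) {k : ℕ} (hk : k ≤ n) :
    ((((Finset.univ : Finset (Fin N)).powersetCard n).filter fun R' => (R ∩ R').card = k).card : ℝ)
      ≤ N.choose n * overlapBound n N k := by
  set P := (Finset.univ : Finset (Fin N)).powersetCard n with hP
  rw [overlapBound, mul_min_of_nonneg _ _ (Nat.cast_nonneg _), mul_one]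
  refine le_min ?_ ?_
  · have := Finset.card_filter_le P fun R' => (R ∩ R').card = k
    rw [hP, Finset.card_powersetCard, Finset.card_univ, Fintype.card_fin] at this
    exact_mod_cast this
  -- Union bound over the `k`-subsets of `R`: the indicator of overlap `k` is at most `(R ∩
  -- R').card.choose k`.
  · have h1 : (P.filter fun R' => (R ∩ R').card = k).card ≤ n.choose k * (N - k).choose (n - k) := by
      have := sum_choose_card_inter (Finset.subset_univ R) hk
      rw [hR, Finset.card_univ, Fintype.card_fin] at this
      rw [← this, Finset.card_filter]
      refine Finset.sum_le_sum fun R' _ => ?_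
      split_ifs with h
      · rw [h, Nat.choose_self]
      · exact Nat.zero_le _
    calc _ ≤ (n.choose k * (N - k).choose (n - k) : ℝ) := by exact_mod_cast h1
      _ ≤ (Real.exp 1 * n / k) ^ k * (N.choose n * ((n : ℝ) / N) ^ k) :=
        mul_le_mul (choose_le_exp_mul_div_pow n k) (choose_sub_sub_le hk hN hn)
          (Nat.cast_nonneg _) (by positivity)
      _ = _ := by
        rw [mul_left_comm, ← mul_pow]
        congr 2
        rw [div_mul_div_comm, mul_comm (k : ℝ)]
        ring

/-- Each of the `n + 1` possible overlaps contributes at most `N.choose n`, since weight and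
probability bound cancel. This turns the pointwise hypothesis on large overlaps into a bound on
their sum. -/
lemma sum_inv_overlapBound_le {n N : ℕ} (hn : 0 < n) (hN : n ≤ N) {R : Finset (Fin N)}
    (hR : R.card = n) :
    ∑ R' ∈ (Finset.univ : Finset (Fin N)).powersetCard n, (overlapBound n N (R ∩ R').card)⁻¹
      ≤ (n + 1) * N.choose n := by
  have hmaps : ∀ R' ∈ (Finset.univ : Finset (Fin N)).powersetCard n,
      (R ∩ R').card ∈ Finset.range (n + 1) := fun R' _ =>
    Finset.mem_range.2 (Nat.lt_succ_of_le (hR ▸ Finset.card_le_card Finset.inter_subset_left))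
  rw [← Finset.sum_fiberwise_of_maps_to hmaps]
  calc _ ≤ ∑ k ∈ Finset.range (n + 1), (N.choose n : ℝ) := by
        refine Finset.sum_le_sum fun k hk => ?_
        rw [Finset.sum_congr rfl fun R' hR' => by rw [(Finset.mem_filter.1 hR').2],
          Finset.sum_const, nsmul_eq_mul, ← div_eq_mul_inv,
          div_le_iff₀ (overlapBound_pos hn hN k)]
        exact card_filter_card_inter_le hn hN hR (Nat.lt_succ_iff.1 (Finset.mem_range.1 hk))
    _ = _ := by simp

lemma sum_card_inter_le {n N : ℕ} (hn : 0 < n) (hN : n ≤ N) {R : Finset (Fin N)}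
    (hR : R.card = n) :
    ∑ R' ∈ (Finset.univ : Finset (Fin N)).powersetCard n, ((R ∩ R').card : ℝ)
      ≤ n ^ 2 / N * N.choose n := by
  have h := sum_choose_card_inter (Finset.subset_univ R) (k := 1) hn
  simp only [Nat.choose_one_right, hR, Finset.card_univ, Fintype.card_fin] at h
  have h' := choose_sub_sub_le (k := 1) hn hN hn
  calc _ = (n * (N - 1).choose (n - 1) : ℝ) := by exact_mod_cast h
    _ ≤ n * (N.choose n * ((n : ℝ) / N) ^ 1) := by gcongr
    _ = _ := by ring

lemma sum_overlap_le {n N : ℕ} (hn : 0 < n) (hN : n ≤ N) {R C : Finset (Fin N)}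
    (hR : R.card = n) (hC : C.card = n) {F : ℕ → ℕ → ℝ} {a b ε : ℝ} (ha : 0 ≤ a) (hε : 0 ≤ ε)
    (hsmall : ∀ k l : ℕ, (k : ℝ) ≤ b → (l : ℝ) ≤ b → F k l ≤ 1 + a * (k * l))
    (hlarge : ∀ k l : ℕ, k ≤ n → l ≤ n → b < k ∨ b < l →
      overlapBound n N k * overlapBound n N l * F k l ≤ ε) :
    ∑ v ∈ (Finset.univ : Finset (Fin N)).powersetCard n ×ˢ Finset.univ.powersetCard n,
      F (R ∩ v.1).card (C ∩ v.2).card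
      ≤ (N.choose n : ℝ) ^ 2 * (1 + (a * (n ^ 2 / N) ^ 2 + (n + 1) ^ 2 * ε)) := by
  set P := (Finset.univ : Finset (Fin N)).powersetCard n with hP
  have hPc : (P.card : ℝ) = N.choose n := by
    rw [hP, Finset.card_powersetCard, Finset.card_univ, Fintype.card_fin]
  -- Every term on the right is a constant times a product of a function of the row overlap and one
  -- of the column overlap, so the double sum factorises.
  have hpt (v : Finset (Fin N) × Finset (Fin N)) : F (R ∩ v.1).card (C ∩ v.2).card ≤
      1 + a * ((R ∩ v.1).card * (C ∩ v.2).card) + ε * ((overlapBound n N (R ∩ v.1).card)⁻¹ *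
        (overlapBound n N (C ∩ v.2).card)⁻¹) := by
    have hw1 := overlapBound_pos hn hN (R ∩ v.1).card
    have hw2 := overlapBound_pos hn hN (C ∩ v.2).card
    by_cases h : ((R ∩ v.1).card : ℝ) ≤ b ∧ ((C ∩ v.2).card : ℝ) ≤ b
    · exact (hsmall _ _ h.1 h.2).trans (le_add_of_nonneg_right (by positivity))
    · have hl := hlarge (R ∩ v.1).card (C ∩ v.2).card
        (hR ▸ Finset.card_le_card Finset.inter_subset_left)
        (hC ▸ Finset.card_le_card Finset.inter_subset_left)
        (by rwa [not_and_or, not_le, not_le] at h)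
      have : F (R ∩ v.1).card (C ∩ v.2).card ≤ ε * ((overlapBound n N (R ∩ v.1).card)⁻¹ *
          (overlapBound n N (C ∩ v.2).card)⁻¹) := by
        rw [← mul_inv, ← div_eq_mul_inv, le_div_iff₀ (by positivity)]
        linarith
      have h0 : 0 ≤ 1 + a * (((R ∩ v.1).card : ℝ) * (C ∩ v.2).card) := by positivity
      linarith
  refine (Finset.sum_le_sum fun v _ => hpt v).trans ?_
  rw [Finset.sum_add_distrib, Finset.sum_add_distrib, ← Finset.mul_sum, ← Finset.mul_sum,
    Finset.sum_const, Finset.card_product]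
  simp_rw [Finset.sum_product]
  simp_rw [← Finset.mul_sum, ← Finset.sum_mul]
  have i1 := sum_card_inter_le hn hN hR
  have i2 := sum_card_inter_le hn hN hC
  have i3 := sum_inv_overlapBound_le hn hN hR
  have i4 := sum_inv_overlapBound_le hn hN hC
  have j1 := mul_le_mul i1 i2 (Finset.sum_nonneg fun _ _ => Nat.cast_nonneg _) (by positivity)
  have j2 := mul_le_mul i3 i4 (Finset.sum_nonneg fun v _ =>
    (inv_pos.2 (overlapBound_pos hn hN (C ∩ v).card)).le) (by positivity)
  calc _ ≤ (N.choose n : ℝ) ^ 2 + a * (n ^ 2 / N * N.choose n * (n ^ 2 / N * N.choose n))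
        + ε * ((n + 1) * N.choose n * ((n + 1) * N.choose n)) := by
        refine add_le_add (add_le_add (le_of_eq ?_) (mul_le_mul_of_nonneg_left j1 ha))
          (mul_le_mul_of_nonneg_left j2 hε)
        rw [nsmul_eq_mul, mul_one, Nat.cast_mul, hPc, sq]
    _ = _ := by ring

/-! ### From the worst-case risk to the uniform mixture of spikes. -/

lemma spike_product_mem_altSet {A : ℝ} {n N : ℕ} {R C : Finset (Fin N)} (hR : R.card = n)
    (hC : C.card = n) : spike A (R ×ˢ C) ∈ altSet A n N :=
  ⟨R, C, hR, hC, fun i j hi hj => by simp [spike, hi, hj],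
    fun i j h => if_neg (by simpa using h)⟩

lemma bddAbove_range_law_real {N : ℕ} (Θ : Set (Obs N)) (B : Set (Obs N)) :
    BddAbove (Set.range fun θ : Θ => (law θ.1).real B) :=
  ⟨1, by rintro _ ⟨θ, rfl⟩; exact measureReal_le_one⟩

lemma risk_nonneg {N : ℕ} (T : Test N) (A : ℝ) (n : ℕ) : 0 ≤ risk T A n :=
  add_nonneg measureReal_nonneg (Real.iSup_nonneg fun _ => measureReal_nonneg)

lemma one_sub_risk_le {n N : ℕ} (hn : 0 < n) (hN : n ≤ N) (T : Test N)
    {A η a b ε : ℝ} (hA : 0 ≤ A) (hη : 0 ≤ η) (ha : 0 ≤ a) (hε : 0 ≤ ε)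
    (hsmall : ∀ k l : ℕ, (k : ℝ) ≤ b → (l : ℝ) ≤ b → Real.exp (A ^ 2 * (1 + 2 * η) *
      (n ^ 2 * (k * l) / (n ^ 2 + k * l))) ≤ 1 + a * (k * l))
    (hlarge : ∀ k l : ℕ, k ≤ n → l ≤ n → b < k ∨ b < l →
      overlapBound n N k * overlapBound n N l * Real.exp (A ^ 2 * (1 + 2 * η) *
        (n ^ 2 * (k * l) / (n ^ 2 + k * l))) ≤ ε) :
    1 - risk T A n ≤ Real.sqrt (2 * Real.exp (-(A ^ 2 * n ^ 2 * η ^ 2 / 2)) +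
      (a * (n ^ 2 / N) ^ 2 + (n + 1) ^ 2 * ε)) := by
  set P := (Finset.univ : Finset (Fin N)).powersetCard n with hP
  have hPc : P.card = N.choose n := by
    rw [hP, Finset.card_powersetCard, Finset.card_univ, Fintype.card_fin]
  have hPP : (P ×ˢ P).card = N.choose n ^ 2 := by rw [Finset.card_product, hPc, sq]
  have hPne : (P ×ˢ P).Nonempty := by
    rw [← Finset.card_pos, hPP]
    exact pow_pos (Nat.choose_pos hN) 2
  have hmem (v : Finset (Fin N) × Finset (Fin N)) (hv : v ∈ P ×ˢ P) :
      v.1.card = n ∧ v.2.card = n := by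
    simpa [hP, Finset.mem_powersetCard] using hv
  have hcomp : {x | T.1 x = 1} = {x | T.1 x = 0}ᶜ := by
    ext x
    simp only [Set.mem_ofPred_eq, Set.mem_compl_iff]
    omega
  have hB : MeasurableSet {x | T.1 x = 0} := T.2 (measurableSet_singleton 0)
  have key := law_zero_sub_average_le (P ×ˢ P) hPne (fun v => v.1 ×ˢ v.2) (m := n ^ 2)
    (by positivity) (fun v hv => by rw [Finset.card_product, (hmem v hv).1, (hmem v hv).2, sq])
    hA hη (D := a * (n ^ 2 / N) ^ 2 + (n + 1) ^ 2 * ε) (fun v hv => by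
      have := sum_overlap_le hn hN (hmem v hv).1 (hmem v hv).2 (F := fun k l =>
        Real.exp (A ^ 2 * (1 + 2 * η) * (n ^ 2 * (k * l) / (n ^ 2 + k * l)))) ha hε hsmall hlarge
      rw [hPP]
      simp only [Finset.product_inter_product, Finset.card_product]
      push_cast
      exact this) hB
  have havg : (∑ v ∈ P ×ˢ P, (law (spike A (v.1 ×ˢ v.2))).real {x | T.1 x = 0}) / (P ×ˢ P).card
      ≤ ⨆ θ : altSet A n N, (law θ.1).real {x | T.1 x = 0} := by
    rw [div_le_iff₀ (by exact_mod_cast hPne.card_pos), mul_comm, ← nsmul_eq_mul]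
    refine Finset.sum_le_card_nsmul _ _ _ fun v hv => ?_
    exact le_ciSup (bddAbove_range_law_real (altSet A n N) _)
      (⟨_, spike_product_mem_altSet (hmem v hv).1 (hmem v hv).2⟩ : altSet A n N)
  rw [risk, hcomp, probReal_compl_eq_one_sub hB]
  push_cast at key
  linarith

/-! ### Risk of the sum test. -/

lemma gaussianReal_Iic_zero_eq (μ : ℝ) {N : ℕ} (hN : 0 < N) :
    gaussianReal μ ((N : NNReal) ^ 2) (Set.Iic 0) = gaussianReal 0 1 (Set.Iic (-(μ / N))) := by
  have h0 : (0 : ℝ) < N := by exact_mod_cast hN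
  have h : gaussianReal μ ((N : NNReal) ^ 2)
      = (gaussianReal 0 1).map (fun x => N * x + μ) := by
    have : (fun x : ℝ => N * x + μ) = (fun x => x + μ) ∘ (fun x => N * x) := rfl
    rw [this, ← Measure.map_map (by fun_prop) (by fun_prop), gaussianReal_map_const_mul,
      gaussianReal_map_add_const]
    congr 1
    · simp
    · ext; simp
  rw [h, Measure.map_apply (by fun_prop) measurableSet_Iic]
  congr 1
  ext x
  simp only [Set.mem_preimage, Set.mem_Iic]
  rw [le_neg, div_le_iff₀ h0]
  constructor <;> intro h <;> linarith

lemma law_real_sum_nonpos {N : ℕ} (hN : 0 < N) (θ : Obs N) :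
    (law θ).real {x | ∑ p, x p ≤ 0} = (gaussianReal 0 1).real (Set.Iic (-((∑ p, θ p) / N))) := by
  have hm : Measurable fun x : Obs N => ∑ p, x p := by fun_prop
  rw [measureReal_def, measureReal_def, ← gaussianReal_Iic_zero_eq _ hN, ← law_map_sum,
    Measure.map_apply hm measurableSet_Iic]
  rfl

lemma gaussianReal_real_Iic_zero : (gaussianReal 0 1).real (Set.Iic 0) = 1 / 2 := by
  have h1 : (gaussianReal 0 1).real (Set.Iic 0) = (gaussianReal 0 1).real (Set.Ioi 0) := by
    have h := gaussianReal_map_neg (μ := 0) (v := 1)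
    rw [neg_zero] at h
    have hna : NullSingletonClass (gaussianReal 0 1) := nullSingletonClass_gaussianReal one_ne_zero
    rw [measureReal_def, measureReal_def, measure_congr Ioi_ae_eq_Ici]
    conv_rhs => rw [← h]
    rw [Measure.map_apply measurable_neg measurableSet_Ici]
    congr 2
    ext x
    simp
  have h2 := probReal_compl_eq_one_sub (μ := gaussianReal 0 1) (measurableSet_Iic (a := (0 : ℝ)))
  rw [Set.compl_Iic] at h2
  linarith

/-- On `[-1, 0]` the standard normal density is at least its value at `1`. -/
lemma gaussianReal_real_Iic_neg_le {y : ℝ} (hy0 : 0 ≤ y) (hy1 : y ≤ 1) :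
    (gaussianReal 0 1).real (Set.Iic (-y)) ≤ 1 / 2 - gaussianPDFReal 0 1 1 * y := by
  have hsplit : (gaussianReal 0 1).real (Set.Iic 0)
      = (gaussianReal 0 1).real (Set.Iic (-y)) + (gaussianReal 0 1).real (Set.Ioc (-y) 0) := by
    have hdisj : Disjoint (Set.Iic (-y)) (Set.Ioc (-y) 0) :=
      Set.disjoint_left.2 fun x h h' => not_lt.2 (Set.mem_Iic.1 h) h'.1
    rw [← Set.Iic_union_Ioc_eq_Iic (neg_nonpos.2 hy0), measureReal_union hdisj measurableSet_Ioc]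
  have hpos : gaussianPDFReal 0 1 1 * y ≤ (gaussianReal 0 1).real (Set.Ioc (-y) 0) := by
    rw [measureReal_def, gaussianReal_apply_eq_integral _ one_ne_zero, ENNReal.toReal_ofReal
      (integral_nonneg fun _ => gaussianPDFReal_nonneg _ _ _)]
    calc gaussianPDFReal 0 1 1 * y = ∫ _ in Set.Ioc (-y) 0, gaussianPDFReal 0 1 1 := by
          simp [hy0, mul_comm]
      _ ≤ _ := by
          refine setIntegral_mono_on (integrable_const _)
            (integrable_gaussianPDFReal _ _).integrableOn measurableSet_Ioc fun x hx => ?_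
          simp only [gaussianPDFReal]
          refine mul_le_mul_of_nonneg_left (Real.exp_le_exp.2 ?_) (by positivity)
          have : x ^ 2 ≤ 1 := by nlinarith [hx.1, hx.2]
          simp only [NNReal.coe_one, sub_zero]
          linarith
  rw [gaussianReal_real_Iic_zero] at hsplit
  linarith

lemma card_mul_le_sum_of_mem_altSet {A : ℝ} {n N : ℕ} {θ : Obs N} (hθ : θ ∈ altSet A n N) :
    A * n ^ 2 ≤ ∑ p, θ p := by
  obtain ⟨R, C, hR, hC, h1, h0⟩ := hθ
  have hsum : ∑ p ∈ R ×ˢ C, θ p = ∑ p, θ p := by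
    refine Finset.sum_subset (Finset.subset_univ _) fun p _ hp => h0 p.1 p.2 ?_
    simpa using hp
  have hcard : (R ×ˢ C).card = n * n := by rw [Finset.card_product, hR, hC]
  calc A * n ^ 2 = (R ×ˢ C).card • A := by rw [hcard, nsmul_eq_mul]; push_cast; ring
    _ ≤ ∑ p ∈ R ×ˢ C, θ p := Finset.card_nsmul_le_sum _ _ _ fun p hp => by
        rw [Finset.mem_product] at hp
        exact h1 p.1 p.2 hp.1 hp.2
    _ = _ := hsum

lemma le_one_sub_risk_sumTest {n N : ℕ} (hN : 0 < N) {A y : ℝ} (hy0 : 0 ≤ y)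
    (hy1 : y ≤ 1) (hy : y ≤ A * n ^ 2 / N) :
    gaussianPDFReal 0 1 1 * y ≤ 1 - risk (sumTest N 0) A n := by
  have h0 : (0 : ℝ) < N := by exact_mod_cast hN
  have hB : MeasurableSet {x : Obs N | ∑ p, x p ≤ 0} :=
    measurableSet_le (by fun_prop) measurable_const
  have e0 : {x | (sumTest N 0).1 x = 0} = {x | ∑ p, x p ≤ 0} := by
    ext x
    simp [sumTest]
  have e1 : {x | (sumTest N 0).1 x = 1} = {x | ∑ p, x p ≤ 0}ᶜ := by
    ext x
    simp [sumTest]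
  have hnull : (law (0 : Obs N)).real {x | ∑ p, x p ≤ 0} = 1 / 2 := by
    rw [law_real_sum_nonpos hN]
    simpa using gaussianReal_real_Iic_zero
  have hle := gaussianReal_real_Iic_neg_le hy0 hy1
  have hsup : ⨆ θ : altSet A n N, (law θ.1).real {x | ∑ p, x p ≤ 0}
      ≤ 1 / 2 - gaussianPDFReal 0 1 1 * y := by
    refine Real.iSup_le (fun θ => ?_) (measureReal_nonneg.trans hle)
    rw [law_real_sum_nonpos hN]
    refine (measureReal_mono (Set.Iic_subset_Iic.2 (neg_le_neg (hy.trans ?_)))).trans hle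
    exact div_le_div_of_nonneg_right (card_mul_le_sum_of_mem_altSet θ.2) h0.le
  rw [risk, e0, e1, probReal_compl_eq_one_sub hB, hnull]
  linarith

/-! ### Large overlaps are negligible. -/

lemma overlapBound_le_exp {n N k : ℕ} (hn : 0 < n) (hk : 0 < k) {α : ℝ}
    (hN : (n : ℝ) ^ (1 + α) ≤ 2 * N) :
    overlapBound n N k
      ≤ Real.exp (k * (Real.log 2 + 1 + (1 - α) * Real.log n - Real.log k)) := by
  have hn' : (0 : ℝ) < n := by exact_mod_cast hn
  have hk' : (0 : ℝ) < k := by exact_mod_cast hk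
  have hpow : (0 : ℝ) < (n : ℝ) ^ (1 + α) := Real.rpow_pos_of_pos hn' _
  have hN0 : (0 : ℝ) < N := by linarith
  refine (min_le_right _ _).trans ?_
  rw [Real.exp_nat_mul, Real.exp_sub, Real.exp_add, Real.exp_add, Real.exp_log two_pos,
    Real.exp_log hk', mul_comm (1 - α), ← Real.rpow_def_of_pos hn']
  refine pow_le_pow_left₀ (by positivity) ?_ k
  rw [div_le_div_iff₀ (by positivity) hk']
  have h2 : (n : ℝ) ^ (1 - α) * n ^ (1 + α) = n ^ 2 := by
    rw [← Real.rpow_add hn', ← Real.rpow_natCast]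
    congr 1
    norm_num
  calc Real.exp 1 * n ^ 2 * k = Real.exp 1 * k * n ^ (1 - α) * n ^ (1 + α) := by rw [← h2]; ring
    _ ≤ Real.exp 1 * k * n ^ (1 - α) * (2 * N) := by gcongr
    _ = _ := by ring

/-- AM-GM twice: with `g = √(k l)`, the left side is at most `2 g ≤ k + l`. Equality at `k = l = m`
makes the exponent match the entropy at full overlap with no loss of constant. It also splits the
exponent into a row part and a column part. -/
lemma four_mul_div_le_add {m k l : ℝ} (hm : 0 < m) (hk : 0 ≤ k) (hl : 0 ≤ l) :
    4 * (m * (k * l) / (m ^ 2 + k * l)) ≤ k + l := by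
  have hkl : 0 ≤ k * l := mul_nonneg hk hl
  rw [← mul_div_assoc, div_le_iff₀ (by positivity)]
  rcases (add_nonneg hk hl).eq_or_lt with h | h
  · have : k = 0 := by linarith
    simp [this] at h ⊢
    simp [← h]
  · refine le_of_mul_le_mul_left ?_ h
    nlinarith [sq_nonneg ((k + l) * m - 2 * (k * l)), mul_nonneg hkl (sq_nonneg (k - l))]

/-- With `k` the larger overlap there are two regimes. If `l ≤ r n`, the exponent is at most a small
multiple of `k log n`, and the row probability alone beats it since `k > n ^ β` with `β > 1 - α`. If
`l > r n`, each overlapping row or column costs about `α log n` and gains at most `α q log n`, so `q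
< 1` decides. -/
lemma overlapBound_mul_exp_le_of_le {n N k l : ℕ} (hn : 0 < n) (hNn : n ≤ N) {α β q r : ℝ}
    (hα : 0 < α) (hq0 : 0 ≤ q) (hq1 : q ≤ 1) (hr : 0 < r)
    (hr' : 4 * α * r ≤ (α + β - 1) / 2)
    (hN : (n : ℝ) ^ (1 + α) ≤ 2 * N)
    (h1 : Real.log 2 + 2 ≤ (α + β - 1) / 2 * Real.log n)
    (h2 : Real.log 2 + 2 - Real.log r ≤ (1 - q) * α * Real.log n)
    (hlk : l ≤ k) (hk : (n : ℝ) ^ β < k) :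
    overlapBound n N k * overlapBound n N l * Real.exp (4 * α * q * Real.log n / n *
      (n ^ 2 * (k * l) / (n ^ 2 + k * l))) ≤ Real.exp (-(n : ℝ) ^ β) := by
  have hn' : (0 : ℝ) < n := by exact_mod_cast hn
  have hk0 : (0 : ℝ) < k := (Real.rpow_pos_of_pos hn' _).trans hk
  have hkn : 0 < k := by exact_mod_cast hk0
  have hl0 : (0 : ℝ) ≤ l := Nat.cast_nonneg l
  have hlk' : (l : ℝ) ≤ k := by exact_mod_cast hlk
  have ht : 0 ≤ Real.log n := Real.log_natCast_nonneg n
  have hwk := overlapBound_le_exp hn hkn hN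
  have hwk0 := overlapBound_pos hn hNn k
  have hwl0 := overlapBound_pos hn hNn l
  rcases le_or_gt (l : ℝ) (r * n) with hl | hl
  · have hlogk : β * Real.log n ≤ Real.log k := by
      rw [← Real.log_rpow hn']
      exact Real.log_le_log (Real.rpow_pos_of_pos hn' _) hk.le
    have hf : 4 * α * q * Real.log n / n * (n ^ 2 * (k * l) / (n ^ 2 + k * l))
        ≤ k * ((α + β - 1) / 2 * Real.log n) := by
      calc _ ≤ 4 * α * q * Real.log n / n * (k * l) := by
            gcongr
            rw [div_le_iff₀ (by positivity)]
            nlinarith [mul_nonneg (mul_nonneg hk0.le hl0) (mul_nonneg hk0.le hl0)]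
        _ ≤ 4 * α * 1 * Real.log n / n * (k * (r * n)) := by gcongr
        _ = k * (4 * α * r * Real.log n) := by field_simp
        _ ≤ _ := by gcongr
    calc _ ≤ Real.exp (k * (Real.log 2 + 1 + (1 - α) * Real.log n - Real.log k)) * 1 *
          Real.exp (k * ((α + β - 1) / 2 * Real.log n)) := by
          gcongr
          exact min_le_left _ _
      _ = Real.exp (k * (Real.log 2 + 1 + (1 - α) * Real.log n - Real.log k
            + (α + β - 1) / 2 * Real.log n)) := by rw [mul_one, ← Real.exp_add]; ring_nf
      _ ≤ Real.exp (k * (-1)) := by gcongr; linarith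
      _ ≤ _ := by gcongr; linarith
  · have hl1 : (0 : ℝ) < l := lt_of_le_of_lt (by positivity) hl
    have hln : 0 < l := by exact_mod_cast hl1
    have hwl := overlapBound_le_exp hn hln hN
    have hlogl : Real.log r + Real.log n ≤ Real.log l := by
      rw [← Real.log_mul hr.ne' hn'.ne']
      exact Real.log_le_log (by positivity) hl.le
    have hlogk : Real.log l ≤ Real.log k := Real.log_le_log hl1 hlk'
    have hf : 4 * α * q * Real.log n / n * (n ^ 2 * (k * l) / (n ^ 2 + k * l))
        ≤ α * q * Real.log n * (k + l) := by
      calc _ = α * q * Real.log n * (4 * (n * (k * l) / (n ^ 2 + k * l))) := by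
            field_simp
        _ ≤ _ := mul_le_mul_of_nonneg_left (four_mul_div_le_add hn' hk0.le hl0) (by positivity)
    have hbase {j : ℝ} (hj : Real.log r + Real.log n ≤ Real.log j) :
        Real.log 2 + 1 + (1 - α) * Real.log n - Real.log j + α * q * Real.log n ≤ -1 := by
      linarith
    calc _ ≤ Real.exp (k * (Real.log 2 + 1 + (1 - α) * Real.log n - Real.log k)) *
          Real.exp (l * (Real.log 2 + 1 + (1 - α) * Real.log n - Real.log l)) *
          Real.exp (α * q * Real.log n * (k + l)) := by gcongr
      _ = Real.exp (k * (Real.log 2 + 1 + (1 - α) * Real.log n - Real.log k + α * q * Real.log n)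
            + l * (Real.log 2 + 1 + (1 - α) * Real.log n - Real.log l + α * q * Real.log n)) := by
          rw [← Real.exp_add, ← Real.exp_add]; ring_nf
      _ ≤ Real.exp (k * (-1) + l * (-1)) := by
          gcongr
          exacts [hbase (hlogl.trans hlogk), hbase hlogl]
      _ ≤ _ := by gcongr; linarith

lemma overlapBound_mul_exp_le {n N k l : ℕ} (hn : 0 < n) (hNn : n ≤ N) {α β q r : ℝ}
    (hα : 0 < α) (hq0 : 0 ≤ q) (hq1 : q ≤ 1) (hr : 0 < r)
    (hr' : 4 * α * r ≤ (α + β - 1) / 2)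
    (hN : (n : ℝ) ^ (1 + α) ≤ 2 * N)
    (h1 : Real.log 2 + 2 ≤ (α + β - 1) / 2 * Real.log n)
    (h2 : Real.log 2 + 2 - Real.log r ≤ (1 - q) * α * Real.log n)
    (hkl : (n : ℝ) ^ β < k ∨ (n : ℝ) ^ β < l) :
    overlapBound n N k * overlapBound n N l * Real.exp (4 * α * q * Real.log n / n *
      (n ^ 2 * (k * l) / (n ^ 2 + k * l))) ≤ Real.exp (-(n : ℝ) ^ β) := by
  rcases le_total l k with h | h
  · have hk : (n : ℝ) ^ β < k := hkl.elim id fun hl => hl.trans_le (by exact_mod_cast h)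
    exact overlapBound_mul_exp_le_of_le hn hNn hα hq0 hq1 hr hr' hN h1 h2 h hk
  · have hl : (n : ℝ) ^ β < l := hkl.elim (fun hk => hk.trans_le (by exact_mod_cast h)) id
    rw [mul_comm (overlapBound n N k), mul_comm (k : ℝ)]
    exact overlapBound_mul_exp_le_of_le hn hNn hα hq0 hq1 hr hr' hN h1 h2 h hl

/-! ### Asymptotics of the signal, the rate and the ambient dimension. -/

lemma signal_sq {δ α : ℝ} (hα : 0 < α) (hδ : -1 < δ) (n : ℕ) :
    signal δ α n ^ 2 = 4 * (1 + δ) * α * Real.log n / n := by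
  have : 0 < 1 + δ := by linarith
  have := Real.log_natCast_nonneg n
  exact Real.sq_sqrt (by positivity)

lemma rate_sq {δ α : ℝ} (hα : 0 < α) (hδ : -1 < δ) (n : ℕ) :
    rate δ α n ^ 2 = (1 + δ) * α * (n : ℝ) ^ (1 - 2 * α) * Real.log n := by
  have : 0 < 1 + δ := by linarith
  have := Real.log_natCast_nonneg n
  rw [rate, mul_pow, mul_pow, Real.sq_sqrt (by positivity), Real.sq_sqrt this,
    ← Real.rpow_natCast, ← Real.rpow_mul (Nat.cast_nonneg n)]
  congr 3
  push_cast
  ring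

lemma rate_nonneg (δ α : ℝ) (n : ℕ) : 0 ≤ rate δ α n := by
  unfold rate; positivity

lemma rate_pos {δ α : ℝ} (hα : 0 < α) (hδ : -1 < δ) {n : ℕ} (hn : 2 ≤ n) : 0 < rate δ α n := by
  have : 0 < 1 + δ := by linarith
  have h1 : (1 : ℝ) < n := by exact_mod_cast hn
  have := Real.log_pos h1
  unfold rate
  positivity

lemma ambientDim_le (n : ℕ) (α : ℝ) : (ambientDim n α : ℝ) ≤ (n : ℝ) ^ (1 + α) :=
  Nat.floor_le (by positivity)

lemma le_ambientDim {n : ℕ} (hn : 0 < n) {α : ℝ} (hα : 0 < α) : n ≤ ambientDim n α := by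
  refine Nat.le_floor ?_
  calc (n : ℝ) = (n : ℝ) ^ (1 : ℝ) := (Real.rpow_one _).symm
    _ ≤ _ := Real.rpow_le_rpow_of_exponent_le (by exact_mod_cast hn) (by linarith)

lemma rpow_le_two_mul_ambientDim {n : ℕ} (hn : 0 < n) {α : ℝ} (hα : 0 < α) :
    (n : ℝ) ^ (1 + α) ≤ 2 * ambientDim n α := by
  have h1 : (n : ℝ) ^ (1 + α) < ambientDim n α + 1 := Nat.lt_floor_add_one _
  have h2 : (1 : ℝ) ≤ ambientDim n α := by exact_mod_cast hn.trans_le (le_ambientDim hn hα)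
  linarith

/-- Equality would hold with `n ^ (1 + α)` in place of its floor; rounding down only helps. -/
lemma two_mul_rate_le {δ α : ℝ} (hα : 0 < α) (hδ : -1 < δ) {n : ℕ} (hn : 0 < n) :
    2 * rate δ α n ≤ signal δ α n * n ^ 2 / ambientDim n α := by
  have hn' : (0 : ℝ) < n := by exact_mod_cast hn
  have hN0 : (0 : ℝ) < ambientDim n α := by exact_mod_cast hn.trans_le (le_ambientDim hn hα)
  have ht := Real.log_natCast_nonneg n
  have hδ' : 0 < 1 + δ := by linarith
  have hs : 0 ≤ signal δ α n := Real.sqrt_nonneg _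
  rw [le_div_iff₀ hN0]
  refine (mul_le_mul_of_nonneg_left (ambientDim_le n α)
    (mul_nonneg two_pos.le (rate_nonneg δ α n))).trans ?_
  refine le_of_sq_le_sq ?_ (by positivity)
  rw [mul_pow, mul_pow, mul_pow, signal_sq hα hδ, rate_sq hα hδ]
  refine le_of_eq ?_
  have : (n : ℝ) ^ (1 - 2 * α) * ((n : ℝ) ^ (1 + α)) ^ 2 = n ^ 3 := by
    rw [← Real.rpow_natCast, ← Real.rpow_mul hn'.le, ← Real.rpow_add hn', ← Real.rpow_natCast]
    congr 1
    push_cast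
    ring
  calc _ = 4 * (1 + δ) * α * Real.log n * ((n : ℝ) ^ (1 - 2 * α) * ((n : ℝ) ^ (1 + α)) ^ 2) := by
        ring
    _ = _ := by rw [this]; field_simp

lemma eventually_mul_rpow_mul_exp_neg_rpow_le {β : ℝ} (hβ : 0 < β) (s c : ℝ) {κ : ℝ} (hκ : 0 < κ) :
    ∀ᶠ n : ℕ in atTop, c * ((n : ℝ) ^ s * Real.exp (-(n : ℝ) ^ β)) ≤ κ := by
  have h1 : Tendsto (fun n : ℕ => (n : ℝ) ^ β) atTop atTop :=
    (tendsto_rpow_atTop hβ).comp tendsto_natCast_atTop_atTop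
  have h2 := ((tendsto_rpow_mul_exp_neg_mul_atTop_nhds_zero (s / β) 1 one_pos).comp h1).const_mul c
  rw [mul_zero] at h2
  filter_upwards [h2.eventually_le_const hκ] with n hn
  simp only [Function.comp_apply] at hn
  rwa [← Real.rpow_mul (Nat.cast_nonneg n), mul_div_cancel₀ _ hβ.ne', neg_one_mul] at hn

lemma eventually_mul_log_mul_rpow_le {s : ℝ} (hs : s < 0) (c : ℝ) {κ : ℝ} (hκ : 0 < κ) :
    ∀ᶠ n : ℕ in atTop, c * (Real.log n * (n : ℝ) ^ s) ≤ κ := by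
  have h := (isLittleO_log_rpow_atTop (neg_pos.2 hs)).tendsto_div_nhds_zero
  have h2 := (h.comp tendsto_natCast_atTop_atTop).const_mul c
  rw [mul_zero] at h2
  filter_upwards [h2.eventually_le_const hκ] with n hn
  simp only [Function.comp_apply] at hn
  rwa [Real.rpow_neg (Nat.cast_nonneg n), div_inv_eq_mul] at hn

lemma tendsto_log_natCast_atTop : Tendsto (fun n : ℕ => Real.log n) atTop atTop :=
  Real.tendsto_log_atTop.comp tendsto_natCast_atTop_atTop

lemma add_mul_exp_neg_rpow_le {n : ℕ} {α β κ : ℝ} (hn1 : (1 : ℝ) ≤ n) (ht1 : 1 ≤ Real.log n)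
    (hκ : 0 < κ) (hexp : 6 * ((n : ℝ) ^ (1 + 2 * α) * Real.exp (-(n : ℝ) ^ β)) ≤ κ) :
    2 * Real.exp (-(n : ℝ) ^ β) + (n + 1) ^ 2 * Real.exp (-(n : ℝ) ^ β)
      ≤ κ * (n : ℝ) ^ (1 - 2 * α) * Real.log n := by
  have hn' : (0 : ℝ) < n := by linarith
  have hpow : (n : ℝ) ^ 2 = (n : ℝ) ^ (1 - 2 * α) * (n : ℝ) ^ (1 + 2 * α) := by
    rw [← Real.rpow_add hn', ← Real.rpow_natCast]
    norm_num
  calc _ = (2 + (n + 1) ^ 2) * Real.exp (-(n : ℝ) ^ β) := by ring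
    _ ≤ 6 * n ^ 2 * Real.exp (-(n : ℝ) ^ β) := by gcongr; nlinarith
    _ = (n : ℝ) ^ (1 - 2 * α) * (6 * ((n : ℝ) ^ (1 + 2 * α) * Real.exp (-(n : ℝ) ^ β))) := by
      rw [hpow]; ring
    _ ≤ (n : ℝ) ^ (1 - 2 * α) * κ * 1 := by rw [mul_one]; gcongr
    _ ≤ (n : ℝ) ^ (1 - 2 * α) * κ * Real.log n := by gcongr
    _ = _ := by ring

lemma mean_overlap_mul_le {n : ℕ} {N α κ q : ℝ} (hn' : (0 : ℝ) < n) (hN0 : 0 < N)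
    (hN : (n : ℝ) ^ (1 + α) ≤ 2 * N) (hα0 : 0 < α) (hκ : 0 < κ) (hq : q ≤ 3 / 2 * κ) :
    2 * (4 * α * q * Real.log n / n) * ((n : ℝ) ^ 2 / N) ^ 2
      ≤ 48 * (κ * α * (n : ℝ) ^ (1 - 2 * α) * Real.log n) := by
  have ht := Real.log_natCast_nonneg n
  have hpow : (n : ℝ) ^ 2 / N ≤ 2 * (n : ℝ) ^ (1 - α) := by
    rw [div_le_iff₀ hN0]
    calc (n : ℝ) ^ 2 = (n : ℝ) ^ (1 - α) * (n : ℝ) ^ (1 + α) := by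
          rw [← Real.rpow_add hn', ← Real.rpow_natCast]
          norm_num
      _ ≤ (n : ℝ) ^ (1 - α) * (2 * N) := by gcongr
      _ = _ := by ring
  have hpow2 : ((n : ℝ) ^ (1 - α)) ^ 2 = n * (n : ℝ) ^ (1 - 2 * α) := by
    rw [← Real.rpow_natCast, ← Real.rpow_mul hn'.le]
    nth_rewrite 2 [← Real.rpow_one (n : ℝ)]
    rw [← Real.rpow_add hn']
    congr 1
    push_cast
    ring
  calc _ ≤ 2 * (4 * α * (3 / 2 * κ) * Real.log n / n) * (2 * (n : ℝ) ^ (1 - α)) ^ 2 := by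
        gcongr
    _ = _ := by rw [mul_pow, hpow2]; field_simp; ring

/-! ### Choice of parameters and matching bounds. -/

lemma eventually_one_sub_risk_le {α δ : ℝ} (hα : 1 / 2 < α) (hδ : -1 < δ) (hδ0 : δ < 0) :
    ∀ᶠ n : ℕ in atTop, ∀ T : Test (ambientDim n α),
      1 - risk T (signal δ α n) n ≤ 8 * rate δ α n := by
  have hα0 : 0 < α := by linarith
  have hδ1 : 0 < 1 + δ := by linarith
  -- `β < 1/2` makes `A² k l` vanish for overlaps up to `n ^ β`; `β > 1 - α` puts `n ^ β`
  -- polynomially above the mean overlap. The window is nonempty because `α > 1/2`.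
  obtain ⟨β, hβ, hβ2⟩ : ∃ β, max (1 - α) 0 < β ∧ β < 1 / 2 :=
    exists_between (max_lt (by linarith) (by norm_num))
  rw [max_lt_iff] at hβ
  obtain ⟨hβ1, hβ0⟩ := hβ
  -- The truncation slack must keep `q = (1 + δ)(1 + 2η)` below `1`; here `q = 1 + δ/2 - δ²/2`.
  set η : ℝ := -δ / 4 with hη
  have hη0 : 0 < η := by rw [hη]; linarith
  set q : ℝ := (1 + δ) * (1 + 2 * η) with hq
  have hq0 : 0 < q := by positivity
  have hq1 : q < 1 := by
    rw [hq, hη]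
    nlinarith only [sq_nonneg δ, hδ0]
  have hq32 : q ≤ 3 / 2 * (1 + δ) := by
    rw [hq, mul_comm]
    exact mul_le_mul_of_nonneg_right (by linarith only [hη, hδ]) hδ1.le
  set r : ℝ := (α + β - 1) / 2 / (4 * α) with hr
  have hr0 : 0 < r := by
    have : 0 < α + β - 1 := by linarith
    positivity
  have ht := tendsto_log_natCast_atTop
  filter_upwards [eventually_ge_atTop 1, ht.eventually_ge_atTop 1,
    ht.eventually_ge_atTop ((Real.log 2 + 2) / ((α + β - 1) / 2)),
    ht.eventually_ge_atTop ((Real.log 2 + 2 - Real.log r) / ((1 - q) * α)),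
    ht.eventually_ge_atTop (1 / (2 * (1 + δ) * α * η ^ 2)),
    eventually_mul_log_mul_rpow_le (s := 2 * β - 1) (by linarith) (4 * α) one_pos,
    eventually_mul_rpow_mul_exp_neg_rpow_le hβ0 (1 + 2 * α) 6 (mul_pos hδ1 hα0)]
    with n hn ht1 hl1 hl2 hl3 hsm hexp T
  have hn0 : 0 < n := hn
  have hn' : (0 : ℝ) < n := by exact_mod_cast hn0
  have hn1 : (1 : ℝ) ≤ n := by exact_mod_cast hn
  rw [div_le_iff₀ (by linarith)] at hl1
  rw [div_le_iff₀ (mul_pos (by linarith) hα0)] at hl2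
  rw [div_le_iff₀ (by positivity)] at hl3
  have hNn := le_ambientDim hn0 hα0
  have hN := rpow_le_two_mul_ambientDim hn0 hα0
  have hN0 : (0 : ℝ) < ambientDim n α := by exact_mod_cast hn0.trans_le hNn
  have hsq := signal_sq hα0 hδ n
  have hG : signal δ α n ^ 2 * (1 + 2 * η) = 4 * α * q * Real.log n / n := by
    rw [hsq, hq]; ring
  have hrisk := one_sub_risk_le hn0 hNn T (A := signal δ α n) (η := η) (b := (n : ℝ) ^ β)
    (a := 2 * (4 * α * q * Real.log n / n)) (ε := Real.exp (-(n : ℝ) ^ β))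
    (Real.sqrt_nonneg _) hη0.le (by positivity) (Real.exp_pos _).le
    (fun k l hk hl => by
      rw [hG]
      have hfle : 4 * α * q * Real.log n / n * ((n : ℝ) ^ 2 * (k * l) / (n ^ 2 + k * l))
          ≤ 4 * α * q * Real.log n / n * (k * l) := by
        gcongr
        rw [div_le_iff₀ (by positivity)]
        have : (0 : ℝ) ≤ (k * l) * (k * l) := by positivity
        nlinarith
      have hle1 : 4 * α * q * Real.log n / n * ((k : ℝ) * l) ≤ 1 := by
        calc _ ≤ 4 * α * 1 * Real.log n / n * ((n : ℝ) ^ β * (n : ℝ) ^ β) := by gcongr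
          _ = 4 * α * (Real.log n * (n : ℝ) ^ (2 * β - 1)) := by
            rw [← Real.rpow_add hn', Real.rpow_sub_one hn'.ne', ← two_mul]
            ring
          _ ≤ 1 := hsm
      have hf0 : 0 ≤ 4 * α * q * Real.log n / n * ((n : ℝ) ^ 2 * (k * l) / (n ^ 2 + k * l)) := by
        positivity
      -- `exp x ≤ 1 + 2 x` on `[0, 1]`, the source of the factor `2` in `a`.
      have habs := Real.abs_exp_sub_one_le (abs_le.2 ⟨by linarith, hfle.trans hle1⟩)
      rw [abs_of_nonneg hf0] at habs
      have := (le_abs_self _).trans habs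
      linarith)
    (fun k l _ _ hkl => by
      rw [hG]
      exact overlapBound_mul_exp_le hn0 hNn hα0 hq0.le hq1.le hr0
        (by rw [hr]; field_simp; exact le_rfl) hN
        (by linarith) (by linarith) hkl)
  refine hrisk.trans (Real.sqrt_le_iff.2 ⟨mul_nonneg (by norm_num) (rate_nonneg δ α n), ?_⟩)
  rw [mul_pow, rate_sq hα0 hδ]
  have hnβ : (n : ℝ) ^ β ≤ n := by
    calc (n : ℝ) ^ β ≤ (n : ℝ) ^ (1 : ℝ) := Real.rpow_le_rpow_of_exponent_le hn1 (by linarith)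
      _ = n := Real.rpow_one _
  have hρ : Real.exp (-(signal δ α n ^ 2 * n ^ 2 * η ^ 2 / 2)) ≤ Real.exp (-(n : ℝ) ^ β) := by
    refine Real.exp_le_exp.2 (neg_le_neg (hnβ.trans ?_))
    rw [hsq]
    calc (n : ℝ) = 1 * n := (one_mul _).symm
      _ ≤ (Real.log n * (2 * (1 + δ) * α * η ^ 2)) * n := by gcongr
      _ = _ := by field_simp; ring
  have hsmall := add_mul_exp_neg_rpow_le hn1 ht1 (mul_pos hδ1 hα0) hexp
  have hmain := mean_overlap_mul_le hn' hN0 hN hα0 hδ1 hq32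
  have h0 : 0 ≤ (1 + δ) * α * (n : ℝ) ^ (1 - 2 * α) * Real.log n := by positivity
  -- The main term gives `48 * rate ^ 2` and the remainders `rate ^ 2`; the total is below `8 ^ 2 *
  -- rate ^ 2`.
  linarith

lemma bddBelow_range_risk (N : ℕ) (A : ℝ) (n : ℕ) :
    BddBelow (Set.range fun T : Test N => risk T A n) :=
  ⟨0, by rintro _ ⟨T, rfl⟩; exact risk_nonneg T A n⟩

lemma risk_bounds (α δ : ℝ) (hα : 1 / 2 < α) (hδ : -1 < δ) (hδ0 : δ < 0) :
    ∀ᶠ n : ℕ in atTop,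
      2 * gaussianPDFReal 0 1 1 * rate δ α n
          ≤ 1 - risk (sumTest (ambientDim n α) 0) (signal δ α n) n ∧
        1 - risk (sumTest (ambientDim n α) 0) (signal δ α n) n
          ≤ 1 - minimaxRisk n (signal δ α n) α ∧
        1 - minimaxRisk n (signal δ α n) α ≤ 8 * rate δ α n := by
  have hα0 : 0 < α := by linarith
  have hδ1 : 0 < 1 + δ := by linarith
  filter_upwards [eventually_ge_atTop 1, eventually_one_sub_risk_le hα hδ hδ0,
    eventually_mul_log_mul_rpow_le (s := 1 - 2 * α) (by linarith) (4 * ((1 + δ) * α)) one_pos]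
    with n hn hup hrate
  have hn0 : 0 < n := hn
  have hrate1 : 2 * rate δ α n ≤ 1 := by
    rw [← abs_of_nonneg (mul_nonneg two_pos.le (rate_nonneg δ α n)), ← sq_le_one_iff_abs_le_one,
      mul_pow, rate_sq hα0 hδ]
    linarith
  have hlow := le_one_sub_risk_sumTest (hn0.trans_le (le_ambientDim hn0 hα0))
    (mul_nonneg two_pos.le (rate_nonneg δ α n)) hrate1 (two_mul_rate_le hα0 hδ hn0)
  have hinf : minimaxRisk n (signal δ α n) α
      ≤ risk (sumTest (ambientDim n α) 0) (signal δ α n) n := ciInf_le (bddBelow_range_risk _ _ _) _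
  have hne : Nonempty (Test (ambientDim n α)) := ⟨sumTest _ 0⟩
  have hge : 1 - 8 * rate δ α n ≤ minimaxRisk n (signal δ α n) α :=
    le_ciInf fun T => by linarith [hup T]
  exact ⟨by linarith, by linarith, by linarith⟩

/-- Constants and the `√(log n)` factor disappear on the logarithmic scale, so both sandwiching
bounds share one limit. -/
lemma tendsto_log_mul_rate_div_log {α δ c : ℝ} (hα : 0 < α) (hδ : -1 < δ) (hc : 0 < c) :
    Tendsto (fun n : ℕ => Real.log (c * rate δ α n) / Real.log n) atTop (𝓝 (1 / 2 - α)) := by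
  have hδ1 : 0 < 1 + δ := by linarith
  have ht := tendsto_log_natCast_atTop
  have h1 : Tendsto (fun n : ℕ => Real.log (c * Real.sqrt ((1 + δ) * α)) / Real.log n) atTop
      (𝓝 0) := ht.const_div_atTop _
  have h2 : Tendsto (fun n : ℕ => Real.log (Real.log n) / Real.log n / 2) atTop (𝓝 0) := by
    have := (Real.isLittleO_log_id_atTop.tendsto_div_nhds_zero.comp ht).div_const 2
    simpa using this
  have h3 := (h1.add h2).add_const (1 / 2 - α)
  rw [add_zero, zero_add] at h3
  refine h3.congr' ?_
  filter_upwards [eventually_ge_atTop 2] with n hn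
  have hn1 : (1 : ℝ) < n := by exact_mod_cast hn
  have hn0 : (0 : ℝ) < n := by linarith
  have hl := Real.log_pos hn1
  have hs : 0 < Real.sqrt ((1 + δ) * α) := Real.sqrt_pos.2 (by positivity)
  have hp := Real.rpow_pos_of_pos hn0 (1 / 2 - α)
  rw [rate, ← mul_assoc, ← mul_assoc,
    Real.log_mul (by positivity) (Real.sqrt_pos.2 hl).ne', Real.log_mul (by positivity) hp.ne',
    Real.log_rpow hn0, Real.log_sqrt hl.le]
  field_simp
  ring

end SubmatrixDetection

theorem theorem4 :
    (∀ α δ : ℝ, 1 / 2 < α → -1 < δ → δ < 0 →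
      Tendsto (fun n : ℕ =>
          Real.log (1 - SubmatrixDetection.minimaxRisk n (SubmatrixDetection.signal δ α n) α)
            / Real.log n)
        atTop (𝓝 (1 / 2 - α))) ∧
    (∃ c C : ℝ, 0 < c ∧ 0 < C ∧
      ∀ α δ : ℝ, 1 / 2 < α → -1 < δ → δ < 0 → ∃ n₀ : ℕ, ∀ n : ℕ, n₀ ≤ n →
        (c ≤ (1 - SubmatrixDetection.minimaxRisk n (SubmatrixDetection.signal δ α n) α)
              / SubmatrixDetection.rate δ α n ∧
          (1 - SubmatrixDetection.minimaxRisk n (SubmatrixDetection.signal δ α n) α)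
              / SubmatrixDetection.rate δ α n ≤ C) ∧
        (c ≤ (1 - SubmatrixDetection.risk
                (SubmatrixDetection.sumTest (SubmatrixDetection.ambientDim n α) 0)
                (SubmatrixDetection.signal δ α n) n) / SubmatrixDetection.rate δ α n ∧
          (1 - SubmatrixDetection.risk
                (SubmatrixDetection.sumTest (SubmatrixDetection.ambientDim n α) 0)
                (SubmatrixDetection.signal δ α n) n) / SubmatrixDetection.rate δ α n ≤ C)) := by
  have hφ : 0 < gaussianPDFReal 0 1 1 := gaussianPDFReal_pos 0 1 1 one_ne_zero
  refine ⟨fun α δ hα hδ hδ0 => ?_, 2 * gaussianPDFReal 0 1 1, 8, by positivity, by norm_num,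
    fun α δ hα hδ hδ0 => ?_⟩
  · have hα0 : 0 < α := by linarith
    refine tendsto_of_tendsto_of_tendsto_of_le_of_le'
      (SubmatrixDetection.tendsto_log_mul_rate_div_log hα0 hδ (mul_pos two_pos hφ))
      (SubmatrixDetection.tendsto_log_mul_rate_div_log hα0 hδ (by norm_num : (0 : ℝ) < 8)) ?_ ?_
    all_goals
      filter_upwards [SubmatrixDetection.risk_bounds α δ hα hδ hδ0, eventually_ge_atTop 2]
        with n ⟨h1, h2, h3⟩ hn
      have hr := SubmatrixDetection.rate_pos hα0 hδ hn
      have hl := Real.log_natCast_nonneg n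
      have hpos := (mul_pos (mul_pos two_pos hφ) hr).trans_le (h1.trans h2)
    · exact div_le_div_of_nonneg_right (Real.log_le_log (by positivity) (h1.trans h2)) hl
    · exact div_le_div_of_nonneg_right (Real.log_le_log hpos h3) hl
  · have hα0 : 0 < α := by linarith
    obtain ⟨n₀, hn₀⟩ := eventually_atTop.1
      ((SubmatrixDetection.risk_bounds α δ hα hδ hδ0).and (eventually_ge_atTop 2))
    refine ⟨n₀, fun n hn => ?_⟩
    obtain ⟨⟨h1, h2, h3⟩, hn2⟩ := hn₀ n hn
    have hr := SubmatrixDetection.rate_pos hα0 hδ hn2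
    rw [le_div_iff₀ hr, div_le_iff₀ hr, le_div_iff₀ hr, div_le_iff₀ hr]
    exact ⟨⟨h1.trans h2, h3⟩, h1, h2.trans h3⟩
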